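/- Let $\Gamma=(V,E)$ be a finite simple graph, and identify every edge $e\in E$ with the interval $[0,1]$, so that the parameter values $0$ and $1$ correspond to the two end points $e^-$ and $e^+$ of $e$ (in an arbitrary but fixed order). Let $Y\subseteq\mathbb C^E\times\mathbb C^E$ be the space of all pairs $\big((\varphi(e^-))_{e\in E},(\varphi(e^+))_{e\in E}\big)$ with $\varphi:V\to\mathbb C$, and let $Y^\perp$ be its orthogonal complement. Let $\Delta^{CK}$ (continuity and Kirchhoff conditions) and $\Delta^{KC}$ (anti-Kirchhoff conditions) be the operators $u\mapsto u''$ from their domains $$D(\Delta^{CK})=\{u\in C^2([0,1];\mathbb C^E) : (u(0),u(1))\in Y,\ (-u'(0),u'(1))\in Y^\perp\},$$ $$D(\Delta^{KC})=\{u\in C^2([0,1];\mathbb C^E) : (u(0),u(1))\in Y^\perp,\ (-u'(0),u'(1))\in Y\}$$ to $C([0,1];\mathbb C^E)$. Call an eigenvalue $\lambda$ of $-\Delta^{CK}$ or of $-\Delta^{KC}$ immanent if $\sin\sqrt\lambda\neq 0$, and let its multiplicity be the dimension of its eigenspace. Then $\Gamma$ is bipartite if and only if $-\Delta^{CK}$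 and $-\Delta^{KC}$ have the same immanent eigenvalues with the same multiplicities. -/

import Mathlib

/-- The realization of a simple graph as a network: every edge `e` is identified with the interval
`[0, 1]`, the parameter `0` being glued to the vertex `tail e` and `1` to the vertex `head e`.
This is the choice of an orientation of every edge. -/
structure EdgeParametrization {V : Type*} (G : SimpleGraph V) where
  tail : G.edgeSet → V
  head : G.edgeSet → V
  ends_eq : ∀ e : G.edgeSet, s(tail e, head e) = (e : Sym2 V)

namespace Network

open Set

noncomputable section

section Abstract

set_option linter.unusedSectionVars false

variable {H : Type*} [NormedAddCommGroup H] [InnerProductSpace ℂ H]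

/-- A continuous function on `[0, 1]`, extended by constants to the real line. Only the values on
`[0, 1]` matter below: all derivatives are taken within `[0, 1]`. -/
def extend (u : C(unitInterval, H)) : ℝ → H := IccExtend (zero_le_one' ℝ) u

/-- The first derivative of `u` at `x ∈ [0, 1]` (one-sided at the end points). -/
def deriv₁ (u : C(unitInterval, H)) (x : ℝ) : H := derivWithin (extend u) (Icc 0 1) x

/-- The second derivative of `u` at `x ∈ [0, 1]` (one-sided at the end points). -/
def deriv₂ (u : C(unitInterval, H)) (x : ℝ) : H := derivWithin (deriv₁ u) (Icc 0 1) x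

/-- `u` is twice continuously differentiable on the closed interval `[0, 1]`. -/
def IsC2 (u : C(unitInterval, H)) : Prop := ContDiffOn ℝ 2 (extend u) (Icc 0 1)

theorem extend_add (u v : C(unitInterval, H)) : extend (u + v) = extend u + extend v := rfl

theorem extend_smul (c : ℂ) (u : C(unitInterval, H)) : extend (c • u) = c • extend u := rfl

theorem extend_zero : extend (0 : C(unitInterval, H)) = fun _ => 0 := rfl

theorem IsC2.diff {u : C(unitInterval, H)} (hu : IsC2 u) :
    DifferentiableOn ℝ (extend u) (Icc 0 1) := hu.differentiableOn (by norm_num)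

theorem IsC2.contDiff_deriv {u : C(unitInterval, H)} (hu : IsC2 u) :
    ContDiffOn ℝ 1 (deriv₁ u) (Icc 0 1) :=
  ContDiffOn.derivWithin hu (uniqueDiffOn_Icc zero_lt_one) (by norm_num)

theorem IsC2.continuous_deriv₂ {u : C(unitInterval, H)} (hu : IsC2 u) :
    ContinuousOn (deriv₂ u) (Icc 0 1) :=
  hu.contDiff_deriv.continuousOn_derivWithin (uniqueDiffOn_Icc zero_lt_one) (by norm_num)

theorem deriv₁_add {u v : C(unitInterval, H)} (hu : IsC2 u) (hv : IsC2 v) {x : ℝ}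
    (hx : x ∈ Icc (0 : ℝ) 1) : deriv₁ (u + v) x = deriv₁ u x + deriv₁ v x := by
  rw [deriv₁, extend_add]
  exact derivWithin_add (hu.diff x hx) (hv.diff x hx)

theorem deriv₁_smul (c : ℂ) (u : C(unitInterval, H)) (x : ℝ) :
    deriv₁ (c • u) x = c • deriv₁ u x := by
  rw [deriv₁, extend_smul]
  exact derivWithin_const_smul_field c _

theorem deriv₁_zero (x : ℝ) : deriv₁ (0 : C(unitInterval, H)) x = 0 := by
  rw [deriv₁, extend_zero]; simp

theorem deriv₂_add {u v : C(unitInterval, H)} (hu : IsC2 u) (hv : IsC2 v) {x : ℝ}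
    (hx : x ∈ Icc (0 : ℝ) 1) : deriv₂ (u + v) x = deriv₂ u x + deriv₂ v x := by
  rw [deriv₂, derivWithin_congr (f := deriv₁ u + deriv₁ v)
    (fun y hy => deriv₁_add hu hv hy) (deriv₁_add hu hv hx)]
  exact derivWithin_add (hu.contDiff_deriv.differentiableOn (by norm_num) x hx)
    (hv.contDiff_deriv.differentiableOn (by norm_num) x hx)

theorem deriv₂_smul (c : ℂ) (u : C(unitInterval, H)) (x : ℝ) :
    deriv₂ (c • u) x = c • deriv₂ u x := by
  have h : deriv₁ (c • u) = c • deriv₁ u := funext (deriv₁_smul c u)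
  rw [deriv₂, h]
  exact derivWithin_const_smul_field c _

/-- The boundary values `(u(0), u(1))` in the Hilbert space `H × H`. -/
def boundaryValues (u : C(unitInterval, H)) : WithLp 2 (H × H) := WithLp.toLp 2 (u 0, u 1)

/-- The outer normal derivatives `(-u'(0), u'(1))` in the Hilbert space `H × H`. -/
def boundaryDerivs (u : C(unitInterval, H)) : WithLp 2 (H × H) :=
  WithLp.toLp 2 (-deriv₁ u 0, deriv₁ u 1)

theorem boundaryDerivs_add {u v : C(unitInterval, H)} (hu : IsC2 u) (hv : IsC2 v) :
    boundaryDerivs (u + v) = boundaryDerivs u + boundaryDerivs v := by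
  rw [boundaryDerivs, deriv₁_add hu hv (by simp), deriv₁_add hu hv (by simp), neg_add]
  rfl

theorem boundaryDerivs_smul (c : ℂ) (u : C(unitInterval, H)) :
    boundaryDerivs (c • u) = c • boundaryDerivs u := by
  rw [boundaryDerivs, deriv₁_smul, deriv₁_smul, ← smul_neg]
  rfl

/-- The functions in `C²([0, 1]; H)` that satisfy the boundary conditions
`(u(0), u(1)) ∈ Y` and `(-u'(0), u'(1)) ∈ Yᗮ`. -/
def domain (Y : Submodule ℂ (WithLp 2 (H × H))) : Submodule ℂ C(unitInterval, H) where
  carrier := {u | IsC2 u ∧ boundaryValues u ∈ Y ∧ boundaryDerivs u ∈ Yᗮ}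
  zero_mem' := by
    refine ⟨contDiffOn_const, ?_, ?_⟩
    · exact Y.zero_mem
    · rw [boundaryDerivs, deriv₁_zero, deriv₁_zero, neg_zero]
      exact Yᗮ.zero_mem
  add_mem' := by
    rintro u v ⟨hu, hu0, hu1⟩ ⟨hv, hv0, hv1⟩
    refine ⟨ContDiffOn.add hu hv, Y.add_mem hu0 hv0, ?_⟩
    rw [boundaryDerivs_add hu hv]
    exact Yᗮ.add_mem hu1 hv1
  smul_mem' := by
    rintro c u ⟨hu, hu0, hu1⟩
    refine ⟨ContDiffOn.const_smul c hu, Y.smul_mem c hu0, ?_⟩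
    rw [boundaryDerivs_smul]
    exact Yᗮ.smul_mem c hu1

/-- The second derivative `u ↦ u''` from `domain Y ⊆ C²([0, 1]; H)` to `C([0, 1]; H)`. -/
def laplacian (Y : Submodule ℂ (WithLp 2 (H × H))) :
    C(unitInterval, H) →ₗ.[ℂ] C(unitInterval, H) where
  domain := domain Y
  toFun :=
    { toFun := fun u => ⟨fun x => deriv₂ u.1 x, u.2.1.continuous_deriv₂.domRestrict⟩
      map_add' := fun u v => ContinuousMap.ext fun x => deriv₂_add u.2.1 v.2.1 x.2
      map_smul' := fun c u => ContinuousMap.ext fun x => deriv₂_smul c u.1 x }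

end Abstract

section Spectrum

variable {X : Type*} [AddCommGroup X] [Module ℂ X]

/-- The eigenspace `{u ∈ D(T) | T u = μ u}` of an operator `T` with domain `D(T) ⊆ X`. -/
def eigenspace (T : X →ₗ.[ℂ] X) (μ : ℂ) : Submodule ℂ T.domain :=
  LinearMap.ker (T.toFun - μ • T.domain.subtype)

/-- The multiplicity of `μ`: the dimension of its eigenspace, as a cardinal number. -/
def multiplicity (T : X →ₗ.[ℂ] X) (μ : ℂ) : Cardinal := Module.rank ℂ (eigenspace T μ)

/-- The immanent eigenvalues: the eigenvalues `μ` with `sin √μ ≠ 0`. Whether `sin √μ` vanishes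
does not depend on the branch of the square root. -/
def immanentEigenvalues (T : X →ₗ.[ℂ] X) : Set ℂ :=
  {μ | eigenspace T μ ≠ ⊥ ∧ Complex.sin (Complex.sqrt μ) ≠ 0}

end Spectrum

section Graph

variable {V : Type*} {G : SimpleGraph V} [Fintype G.edgeSet]

/-- The linear map that sends a function `φ` on the vertices to its values
`((φ (tail e))ₑ, (φ (head e))ₑ)` at the initial and at the terminal ends of the edges. In terms of
the signed incidence matrix `D` (with entry `1` at `head e` and `-1` at `tail e`), it is the block
matrix with the blocks `(D⁻)ᵀ` and `(D⁺)ᵀ`, where `D⁺` and `D⁻` consist of the positive and of the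
negative parts of the entries. -/
def endValues (P : EdgeParametrization G) :
    (V → ℂ) →ₗ[ℂ] WithLp 2 (EuclideanSpace ℂ G.edgeSet × EuclideanSpace ℂ G.edgeSet) where
  toFun φ := WithLp.toLp 2
    (WithLp.toLp 2 fun e => φ (P.tail e), WithLp.toLp 2 fun e => φ (P.head e))
  map_add' _ _ := rfl
  map_smul' _ _ := rfl

/-- The Laplacian under the continuity and Kirchhoff conditions: the boundary values come from a
function on the vertices, and at every vertex the outer normal derivatives sum to zero. -/
def laplacianCK (P : EdgeParametrization G) :
    C(unitInterval, EuclideanSpace ℂ G.edgeSet) →ₗ.[ℂ]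
      C(unitInterval, EuclideanSpace ℂ G.edgeSet) :=
  laplacian (LinearMap.range (endValues P))

/-- The Laplacian under the dual (anti-Kirchhoff) conditions: at every vertex the boundary values
sum to zero, and the outer normal derivatives come from a function on the vertices. -/
def laplacianKC (P : EdgeParametrization G) :
    C(unitInterval, EuclideanSpace ℂ G.edgeSet) →ₗ.[ℂ]
      C(unitInterval, EuclideanSpace ℂ G.edgeSet) :=
  laplacian (LinearMap.range (endValues P))ᗮ

end Graph

end

end Network

namespace Network

open Set

noncomputable section

section Swap

variable {H : Type*} [NormedAddCommGroup H] [InnerProductSpace ℂ H]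

/-! Let J exchange the two factors of H × H. For μ = s² with sin s ≠ 0, a solution of u'' = -μu is
determined by its boundary values y = (u(0), u(1)), and its outer normal derivatives are -(s / sin
s)(Jy - cos s · y) (`sin_smul_boundaryDerivs`). So the eigenspace for the conditions given by Y is a
copy of {y ∈ Y | Jy - cy ∈ Yᗮ} with c = cos s, an eigenspace of the compression A of J to Y
(`range_eigenspaceBoundaryValues`). Since J² = 1, the map J - c identifies it for c² ≠ 1 with the
space that belongs to Yᗮ and -c (`rank_compressedEigenspace_orthogonal`). As cos is surjective on ℂ,
the immanent spectra agree iff c and -c have equal multiplicities in A for all c ≠ ±1.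

If Γ is bipartite, multiplication by a ±1 colouring preserves Y and anticommutes with J, so the
spectrum of A is symmetric. Conversely, A has trace zero because Γ has no loops
(`trace_compression_swap`), so symmetry away from ±1 forces equal multiplicities at 1 and -1
(`finrank_eigenspace_one_eq`). These eigenvectors come from vertex functions that are constant,
respectively alternating, along edges. Apart from isolated vertices, the multiplicity of 1 counts
the components and that of -1 the bipartite ones, so every component is bipartite. -/

/-- The involution of `H × H` that exchanges the two factors. -/
def swap (H : Type*) [NormedAddCommGroup H] [InnerProductSpace ℂ H] :
    WithLp 2 (H × H) →ₗ[ℂ] WithLp 2 (H × H) where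
  toFun y := WithLp.toLp 2 (y.snd, y.fst)
  map_add' _ _ := rfl
  map_smul' _ _ := rfl

theorem swap_swap (y : WithLp 2 (H × H)) : swap H (swap H y) = y := rfl

theorem swap_isSymmetric : (swap H).IsSymmetric := by
  intro y z
  rw [WithLp.prod_inner_apply, WithLp.prod_inner_apply]
  exact add_comm _ _

end Swap

/-- The eigenspace at `c` of the compression of `J` to the subspace `Y`. -/
def compressedEigenspace {K : Type*} [NormedAddCommGroup K] [InnerProductSpace ℂ K]
    (J : K →ₗ[ℂ] K) (Y : Submodule ℂ K) (c : ℂ) : Submodule ℂ K :=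
  Y ⊓ Yᗮ.comap (J - c • LinearMap.id)

theorem mem_compressedEigenspace {K : Type*} [NormedAddCommGroup K] [InnerProductSpace ℂ K]
    {J : K →ₗ[ℂ] K} {Y : Submodule ℂ K} {c : ℂ} {y : K} :
    y ∈ compressedEigenspace J Y c ↔ y ∈ Y ∧ J y - c • y ∈ Yᗮ := Iff.rfl

/-! ### Eigenfunctions and their boundary values -/

section Solutions

variable {H : Type*} [NormedAddCommGroup H] [InnerProductSpace ℂ H]

theorem IsC2.hasDerivWithinAt {u : C(unitInterval, H)} (hu : IsC2 u) {x : ℝ}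
    (hx : x ∈ Icc (0 : ℝ) 1) : HasDerivWithinAt (extend u) (deriv₁ u x) (Icc 0 1) x :=
  (hu.diff x hx).hasDerivWithinAt

theorem IsC2.hasDerivWithinAt_deriv₁ {u : C(unitInterval, H)} (hu : IsC2 u) {x : ℝ}
    (hx : x ∈ Icc (0 : ℝ) 1) : HasDerivWithinAt (deriv₁ u) (deriv₂ u x) (Icc 0 1) x :=
  (hu.contDiff_deriv.differentiableOn (by norm_num) x hx).hasDerivWithinAt

theorem hasDerivAt_cos_mul (s : ℂ) (x : ℝ) :
    HasDerivAt (fun x : ℝ => Complex.cos (s * x)) (-(s * Complex.sin (s * x))) x := by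
  have h := (((hasDerivAt_id (x : ℂ)).const_mul s).ccos).comp_ofReal
  simpa [mul_comm] using h

theorem hasDerivAt_sin_mul (s : ℂ) (x : ℝ) :
    HasDerivAt (fun x : ℝ => Complex.sin (s * x)) (s * Complex.cos (s * x)) x := by
  have h := (((hasDerivAt_id (x : ℂ)).const_mul s).csin).comp_ofReal
  simpa [mul_comm] using h

theorem extend_coe {X : Type*} [NormedAddCommGroup X] (u : C(unitInterval, X)) (x : unitInterval) : extend u x = u x :=
  IccExtend_val _ _ _

/-- Two first integrals of the equation `u'' = -s² u`. -/
theorem first_integrals {u : C(unitInterval, H)} (hu : IsC2 u) {s : ℂ}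
    (h : ∀ x ∈ Icc (0 : ℝ) 1, deriv₂ u x = -(s ^ 2 • extend u x)) {x : ℝ}
    (hx : x ∈ Icc (0 : ℝ) 1) :
    Complex.cos (s * x) • deriv₁ u x + (s * Complex.sin (s * x)) • extend u x = deriv₁ u 0 ∧
    Complex.sin (s * x) • deriv₁ u x - (s * Complex.cos (s * x)) • extend u x
      = -(s • extend u 0) := by
  have key : ∀ f : ℝ → H, (∀ x ∈ Icc (0 : ℝ) 1, HasDerivWithinAt f 0 (Icc 0 1) x) →
      f x = f 0 := fun f hf =>
    constant_of_derivWithin_zero (fun y hy => (hf y hy).differentiableWithinAt)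
      (fun y hy => (hf y (Ico_subset_Icc_self hy)).derivWithin
        (uniqueDiffOn_Icc zero_lt_one y (Ico_subset_Icc_self hy))) x hx
  constructor
  · have := key (fun x => Complex.cos (s * x) • deriv₁ u x +
        (s * Complex.sin (s * x)) • extend u x) (fun y hy => by
      have h1 := (hasDerivAt_cos_mul s y).hasDerivWithinAt.smul (hu.hasDerivWithinAt_deriv₁ hy)
      have h2 := ((hasDerivAt_sin_mul s y).const_mul s).hasDerivWithinAt.smul
        (hu.hasDerivWithinAt hy)
      refine (h1.add h2).congr_deriv ?_
      rw [h y hy]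
      module)
    simpa using this
  · have := key (fun x => Complex.sin (s * x) • deriv₁ u x -
        (s * Complex.cos (s * x)) • extend u x) (fun y hy => by
      have h1 := (hasDerivAt_sin_mul s y).hasDerivWithinAt.smul (hu.hasDerivWithinAt_deriv₁ hy)
      have h2 := ((hasDerivAt_cos_mul s y).const_mul s).hasDerivWithinAt.smul
        (hu.hasDerivWithinAt hy)
      refine (h1.sub h2).congr_deriv ?_
      rw [h y hy]
      module)
    simpa using this

/-- The function `cos(s x) a + sin(s x) b` on `[0, 1]`. -/
def trig (s : ℂ) (a b : H) : C(unitInterval, H) where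
  toFun x := Complex.cos (s * (x : ℝ)) • a + Complex.sin (s * (x : ℝ)) • b
  continuous_toFun := by fun_prop

theorem extend_trig (s : ℂ) (a b : H) {x : ℝ} (hx : x ∈ Icc (0 : ℝ) 1) :
    extend (trig s a b) x = Complex.cos (s * x) • a + Complex.sin (s * x) • b :=
  extend_coe (trig s a b) ⟨x, hx⟩

theorem isC2_trig (s : ℂ) (a b : H) : IsC2 (trig s a b) := by
  have h : ContDiff ℝ 2 (fun x : ℝ => Complex.cos (s * x) • a + Complex.sin (s * x) • b) := by
    have h0 : ContDiff ℝ 2 (fun x : ℝ => s * (x : ℂ)) := contDiff_const.mul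
      Complex.ofRealCLM.contDiff
    exact (((Complex.contDiff_cos.restrict_scalars ℝ).comp h0).smul contDiff_const).add
      (((Complex.contDiff_sin.restrict_scalars ℝ).comp h0).smul contDiff_const)
  exact h.contDiffOn.congr fun x hx => extend_trig s a b hx

theorem hasDerivAt_trig (s : ℂ) (a b : H) (x : ℝ) :
    HasDerivAt (fun x : ℝ => Complex.cos (s * x) • a + Complex.sin (s * x) • b)
      (Complex.cos (s * x) • (s • b) + Complex.sin (s * x) • (-(s • a))) x := by
  refine (((hasDerivAt_cos_mul s x).smul_const a).add
    ((hasDerivAt_sin_mul s x).smul_const b)).congr_deriv ?_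
  module

theorem deriv₁_trig (s : ℂ) (a b : H) {x : ℝ} (hx : x ∈ Icc (0 : ℝ) 1) :
    deriv₁ (trig s a b) x = Complex.cos (s * x) • (s • b) + Complex.sin (s * x) • (-(s • a)) := by
  rw [deriv₁, derivWithin_congr (fun y hy => extend_trig s a b hy) (extend_trig s a b hx)]
  exact (hasDerivAt_trig s a b x).hasDerivWithinAt.derivWithin
    (uniqueDiffOn_Icc zero_lt_one x hx)

theorem deriv₂_trig (s : ℂ) (a b : H) {x : ℝ} (hx : x ∈ Icc (0 : ℝ) 1) :
    deriv₂ (trig s a b) x = -(s ^ 2 • extend (trig s a b) x) := by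
  rw [deriv₂, derivWithin_congr (fun y hy => deriv₁_trig s a b hy) (deriv₁_trig s a b hx),
    (hasDerivAt_trig s _ _ x).hasDerivWithinAt.derivWithin (uniqueDiffOn_Icc zero_lt_one x hx),
    extend_trig s a b hx]
  module

theorem mem_eigenspace_neg_laplacian {Y : Submodule ℂ (WithLp 2 (H × H))} {μ : ℂ}
    {u : (-laplacian Y).domain} :
    u ∈ eigenspace (-laplacian Y) μ ↔
      ∀ x ∈ Icc (0 : ℝ) 1, deriv₂ u.1 x = -(μ • extend u.1 x) := by
  rw [eigenspace, LinearMap.mem_ker, LinearMap.sub_apply, sub_eq_zero, ContinuousMap.ext_iff]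
  constructor
  · intro h x hx
    have h' : -deriv₂ u.1 x = μ • u.1 ⟨x, hx⟩ := h ⟨x, hx⟩
    rw [← extend_coe] at h'
    rw [← h', neg_neg]
  · intro h x
    change -deriv₂ u.1 x = μ • u.1 x
    rw [h x x.2, neg_neg, extend_coe]

/-- The boundary values of the eigenfunctions, as a linear map. -/
def eigenspaceBoundaryValues (Y : Submodule ℂ (WithLp 2 (H × H))) (μ : ℂ) :
    eigenspace (-laplacian Y) μ →ₗ[ℂ] WithLp 2 (H × H) where
  toFun u := boundaryValues u.1.1
  map_add' _ _ := rfl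
  map_smul' _ _ := rfl

/-- Eliminates u'(x) from the two first integrals. -/
theorem eq_of_deriv₂_eq {u : C(unitInterval, H)} (hu : IsC2 u) {s : ℂ}
    (h : ∀ x ∈ Icc (0 : ℝ) 1, deriv₂ u x = -(s ^ 2 • extend u x)) {x : ℝ}
    (hx : x ∈ Icc (0 : ℝ) 1) :
    s • extend u x = Complex.sin (s * x) • deriv₁ u 0 + (s * Complex.cos (s * x)) • extend u 0 := by
  obtain ⟨h1, h2⟩ := first_integrals hu h hx
  have e : s • extend u x = (s * (Complex.sin (s * x) ^ 2 + Complex.cos (s * x) ^ 2)) •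
      extend u x := by rw [Complex.sin_sq_add_cos_sq, mul_one]
  rw [← h1, e]
  have h3 : (s * Complex.cos (s * x)) • extend u 0 =
      -(Complex.cos (s * x) • -(s • extend u 0)) := by module
  rw [h3, ← h2]
  module

theorem extend_zero_eq {X : Type*} [NormedAddCommGroup X] (u : C(unitInterval, X)) :
    extend u 0 = u 0 := extend_coe u 0

theorem extend_one_eq {X : Type*} [NormedAddCommGroup X] (u : C(unitInterval, X)) :
    extend u 1 = u 1 := extend_coe u 1

/-- The Dirichlet-to-Neumann relation: the first integrals at x = 1, solved for the derivatives at
both ends and left multiplied by sin s. -/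
theorem sin_smul_boundaryDerivs {u : C(unitInterval, H)} (hu : IsC2 u) {s : ℂ}
    (h : ∀ x ∈ Icc (0 : ℝ) 1, deriv₂ u x = -(s ^ 2 • extend u x)) :
    Complex.sin s • boundaryDerivs u =
      (-s) • (swap H (boundaryValues u) - Complex.cos s • boundaryValues u) := by
  obtain ⟨h1, h2⟩ := first_integrals hu h (right_mem_Icc.2 zero_le_one)
  rw [Complex.ofReal_one, mul_one, extend_one_eq] at h1 h2
  rw [extend_zero_eq] at h2
  have h3 : Complex.sin s • deriv₁ u 1 = (s * Complex.cos s) • u 1 - s • u 0 := by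
    rw [← sub_eq_zero, ← sub_eq_zero.2 h2]; module
  refine (WithLp.equiv 2 (H × H)).injective (Prod.ext ?_ ?_)
  · change Complex.sin s • (-deriv₁ u 0) = (-s) • (u 1 - Complex.cos s • u 0)
    have e : s • u 1 = (s * (Complex.sin s ^ 2 + Complex.cos s ^ 2)) • u 1 := by
      rw [Complex.sin_sq_add_cos_sq, mul_one]
    have e1 : Complex.sin s • deriv₁ u 0 = Complex.cos s • (Complex.sin s • deriv₁ u 1) +
        (s * Complex.sin s ^ 2) • u 1 := by rw [← h1]; module
    rw [smul_neg, e1, h3, neg_smul, smul_sub s, e]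
    module
  · change Complex.sin s • deriv₁ u 1 = (-s) • (u 0 - Complex.cos s • u 1)
    rw [h3]; module

theorem eigenspaceBoundaryValues_injective (Y : Submodule ℂ (WithLp 2 (H × H))) {s : ℂ}
    (hs : Complex.sin s ≠ 0) : Function.Injective (eigenspaceBoundaryValues Y (s ^ 2)) := by
  have hs0 : s ≠ 0 := by rintro rfl; simp at hs
  rw [injective_iff_map_eq_zero]
  intro u hu
  have h := mem_eigenspace_neg_laplacian.1 u.2
  have hC : IsC2 u.1.1 := u.1.2.1
  have hv : boundaryValues u.1.1 = 0 := hu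
  have hd := sin_smul_boundaryDerivs hC h
  rw [hv, map_zero, smul_zero, sub_zero, smul_zero, smul_eq_zero, or_iff_right hs] at hd
  have h0 : extend u.1.1 0 = 0 := (extend_zero_eq _).trans (congrArg WithLp.fst hv)
  have h1 : deriv₁ u.1.1 0 = 0 := neg_eq_zero.1 (congrArg WithLp.fst hd)
  refine Subtype.ext (Subtype.ext (ContinuousMap.ext fun x => ?_))
  have := eq_of_deriv₂_eq hC h x.2
  rw [h0, h1, smul_zero, smul_zero, add_zero, smul_eq_zero, or_iff_right hs0, extend_coe] at this
  exact this

/-- The Dirichlet-to-Neumann relation turns the condition on the derivatives into one on the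
boundary values, as both s and sin s are nonzero. -/
theorem range_eigenspaceBoundaryValues (Y : Submodule ℂ (WithLp 2 (H × H))) {s : ℂ}
    (hs : Complex.sin s ≠ 0) :
    LinearMap.range (eigenspaceBoundaryValues Y (s ^ 2)) =
      compressedEigenspace (swap H) Y (Complex.cos s) := by
  have hs0 : s ≠ 0 := by rintro rfl; simp at hs
  ext y
  rw [mem_compressedEigenspace]
  constructor
  · rintro ⟨u, rfl⟩
    refine ⟨u.1.2.2.1, ?_⟩
    have hd := sin_smul_boundaryDerivs (u := u.1.1) u.1.2.1 (mem_eigenspace_neg_laplacian.1 u.2)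
    have := Yᗮ.smul_mem (Complex.sin s) u.1.2.2.2
    rw [hd] at this
    exact (Yᗮ.smul_mem_iff (neg_ne_zero.2 hs0)).1 this
  · rintro ⟨hy, hy'⟩
    -- The sine coefficient is forced by the prescribed value at 1.
    let u : C(unitInterval, H) :=
      trig s y.fst ((Complex.sin s)⁻¹ • (y.snd - Complex.cos s • y.fst))
    have hC : IsC2 u := isC2_trig _ _ _
    have h : ∀ x ∈ Icc (0 : ℝ) 1, deriv₂ u x = -(s ^ 2 • extend u x) :=
      fun x hx => deriv₂_trig _ _ _ hx
    have hv : boundaryValues u = y := by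
      refine (WithLp.equiv 2 (H × H)).injective (Prod.ext ?_ ?_)
      · change u 0 = y.fst
        simp [u, trig]
      · change u 1 = y.snd
        simp [u, trig, smul_smul, hs]
    have hd := sin_smul_boundaryDerivs hC h
    rw [hv] at hd
    have hm : u ∈ domain Y := by
      refine ⟨hC, hv ▸ hy, (Yᗮ.smul_mem_iff hs).1 ?_⟩
      rw [hd]
      exact Yᗮ.smul_mem _ hy'
    exact ⟨⟨⟨u, hm⟩, mem_eigenspace_neg_laplacian.2 h⟩, hv⟩

theorem sqrt_sq (μ : ℂ) : Complex.sqrt μ ^ 2 = μ := by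
  rw [Complex.sqrt]
  exact_mod_cast Complex.cpow_nat_inv_pow μ two_ne_zero

theorem multiplicity_neg_laplacian (Y : Submodule ℂ (WithLp 2 (H × H))) {μ : ℂ}
    (hμ : Complex.sin (Complex.sqrt μ) ≠ 0) :
    multiplicity (-laplacian Y) μ =
      Module.rank ℂ (compressedEigenspace (swap H) Y (Complex.cos (Complex.sqrt μ))) := by
  rw [multiplicity, ← range_eigenspaceBoundaryValues Y hμ, sqrt_sq]
  have h := eigenspaceBoundaryValues_injective Y hμ
  rw [sqrt_sq] at h
  exact (LinearEquiv.ofInjective _ h).rank_eq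

end Solutions

/-! ### Compressions of an involution -/

section Compression

variable {K : Type*} [NormedAddCommGroup K] [InnerProductSpace ℂ K] {J : K →ₗ[ℂ] K}

theorem rank_le_of_injOn {p q : Submodule ℂ K} (f : K →ₗ[ℂ] K) (hf : ∀ y ∈ p, f y ∈ q)
    (h0 : ∀ y ∈ p, f y = 0 → y = 0) : Module.rank ℂ p ≤ Module.rank ℂ q := by
  refine LinearMap.rank_le_of_injective (f.restrict hf) ?_
  rw [injective_iff_map_eq_zero]
  intro y hy
  exact Subtype.ext (h0 y y.2 (congrArg Subtype.val hy))

/-- J - c sends the first space into Yᗮ by definition, and (J + c)(J - c) = 1 - c² returns the image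
to Y, a nonzero multiple of the original vector. -/
theorem rank_compressedEigenspace_le_orthogonal (hJ : ∀ y, J (J y) = y) (Y : Submodule ℂ K)
    {c : ℂ} (hc : c ^ 2 ≠ 1) :
    Module.rank ℂ (compressedEigenspace J Y c) ≤
      Module.rank ℂ (compressedEigenspace J Yᗮ (-c)) := by
  have key : ∀ y, J ((J - c • LinearMap.id : K →ₗ[ℂ] K) y) -
      (-c) • (J - c • LinearMap.id : K →ₗ[ℂ] K) y = (1 - c ^ 2) • y := by
    intro y
    simp only [LinearMap.sub_apply, LinearMap.smul_apply, LinearMap.id_apply, map_sub, map_smul,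
      hJ]
    module
  refine rank_le_of_injOn (J - c • LinearMap.id) (fun y hy => mem_compressedEigenspace.2 ⟨hy.2, ?_⟩)
    fun y _ h => ?_
  · rw [key]
    exact Submodule.smul_mem _ _ (Y.le_orthogonal_orthogonal hy.1)
  · have := key y
    rw [h, map_zero, smul_zero, sub_zero, eq_comm, smul_eq_zero] at this
    exact this.resolve_left (sub_ne_zero.2 hc.symm)

theorem rank_compressedEigenspace_orthogonal (hJ : ∀ y, J (J y) = y) {Y : Submodule ℂ K}
    (hY : Yᗮᗮ = Y) {c : ℂ} (hc : c ^ 2 ≠ 1) :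
    Module.rank ℂ (compressedEigenspace J Yᗮ c) =
      Module.rank ℂ (compressedEigenspace J Y (-c)) := by
  refine le_antisymm ?_ ?_
  · have := rank_compressedEigenspace_le_orthogonal hJ Yᗮ hc
    rwa [hY] at this
  · have := rank_compressedEigenspace_le_orthogonal hJ Y (c := -c) (by rwa [neg_sq])
    rwa [neg_neg] at this

/-- A symmetric U that preserves Y also preserves Yᗮ; anticommuting with J, it exchanges the spaces
of c and -c. -/
theorem rank_compressedEigenspace_neg {U : K →ₗ[ℂ] K} (hU : ∀ y, U (U y) = y)
    (hsymm : U.IsSymmetric) (hJU : ∀ y, J (U y) = -U (J y)) {Y : Submodule ℂ K}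
    (hUY : ∀ y ∈ Y, U y ∈ Y) (c : ℂ) :
    Module.rank ℂ (compressedEigenspace J Y c) =
      Module.rank ℂ (compressedEigenspace J Y (-c)) := by
  have key : ∀ c, Module.rank ℂ (compressedEigenspace J Y c) ≤
      Module.rank ℂ (compressedEigenspace J Y (-c)) := by
    intro c
    refine rank_le_of_injOn U (fun y hy => mem_compressedEigenspace.2 ⟨hUY y hy.1, ?_⟩)
      fun y _ h => ?_
    · have : J (U y) - -c • U y = -U (J y - c • y) := by
        rw [hJU, map_sub, map_smul]; module
      rw [this, Submodule.neg_mem_iff, Submodule.mem_orthogonal]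
      intro z hz
      rw [← hsymm]
      exact (Submodule.mem_orthogonal _ _).1 (mem_compressedEigenspace.1 hy).2 _ (hUY z hz)
    · rw [← hU y, h, map_zero]
  have := key (-c)
  rw [neg_neg] at this
  exact le_antisymm (key c) this

/-- The defect w = Jy - cy is orthogonal to y and satisfies Jw = -cw, so ⟪w, w⟫ = ⟪w, Jy⟫ = ⟪Jw, y⟫
= 0. -/
theorem mem_compressedEigenspace_of_sq_eq_one (hJ : ∀ y, J (J y) = y) (hsymm : J.IsSymmetric)
    {Y : Submodule ℂ K} {c : ℂ} (hc : c ^ 2 = 1) {y : K} :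
    y ∈ compressedEigenspace J Y c ↔ y ∈ Y ∧ J y = c • y := by
  rw [mem_compressedEigenspace]
  refine and_congr_right fun hy => ⟨fun h => ?_, fun h => by rw [h, sub_self]; exact zero_mem _⟩
  have h1 : inner ℂ (J y - c • y) y = 0 := (Submodule.mem_orthogonal' _ _).1 h y hy
  have h2 : J (J y - c • y) = (-c) • (J y - c • y) := by
    rw [map_sub, map_smul, hJ, smul_sub, smul_smul, neg_mul, ← sq, hc]; module
  rw [← sub_eq_zero, ← inner_self_eq_zero (𝕜 := ℂ), inner_sub_right, inner_smul_right, h1,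
    mul_zero, sub_zero, ← hsymm, h2, inner_smul_left, h1, mul_zero]

/-- The compression of `J` to the subspace `Y`. -/
def compression (J : K →ₗ[ℂ] K) (Y : Submodule ℂ K) [Y.HasOrthogonalProjection] : Y →ₗ[ℂ] Y :=
  Y.orthogonalProjectionOnto.toLinearMap ∘ₗ J ∘ₗ Y.subtype

variable (Y : Submodule ℂ K) [Y.HasOrthogonalProjection]

theorem inner_compression (x y : Y) : inner ℂ x (compression J Y y) = inner ℂ (x : K) (J y) :=
  Submodule.inner_orthogonalProjectionOnto_eq_of_mem_left x (J y)

theorem compression_isSymmetric (hsymm : J.IsSymmetric) : (compression J Y).IsSymmetric := by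
  intro x y
  rw [inner_compression, ← hsymm, ← inner_conj_symm, inner_compression, inner_conj_symm]

theorem map_eigenspace_compression (c : ℂ) :
    (Module.End.eigenspace (compression J Y) c).map Y.subtype = compressedEigenspace J Y c := by
  have key : ∀ y : Y, y ∈ Module.End.eigenspace (compression J Y) c ↔ J y - c • (y : K) ∈ Yᗮ := by
    intro y
    rw [Module.End.mem_eigenspace_iff, ← Submodule.orthogonalProjectionOnto_eq_zero_iff, map_sub,
      map_smul, Submodule.orthogonalProjectionOnto_mem_subspace_eq_self, sub_eq_zero]
    rfl
  ext y
  rw [mem_compressedEigenspace, Submodule.mem_map]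
  constructor
  · rintro ⟨z, hz, rfl⟩
    exact ⟨z.2, (key z).1 hz⟩
  · rintro ⟨hy, h⟩
    exact ⟨⟨y, hy⟩, (key _).2 h, rfl⟩

theorem finrank_eigenspace_compression (c : ℂ) :
    Module.finrank ℂ (Module.End.eigenspace (compression J Y) c) =
      Module.finrank ℂ (compressedEigenspace J Y c) := by
  rw [← map_eigenspace_compression]
  exact (Submodule.finrank_map_subtype_eq _ _).symm

end Compression

/-! ### Trace and spectral symmetry -/

section Trace

variable {E : Type*} [NormedAddCommGroup E] [InnerProductSpace ℂ E] [FiniteDimensional ℂ E]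
  {A : E →ₗ[ℂ] E}

theorem finite_eigenspace_ne_bot (A : E →ₗ[ℂ] E) : {c : ℂ | Module.End.eigenspace A c ≠ ⊥}.Finite :=
  Module.End.finite_hasEigenvalue A

/-- `S` may exceed the spectrum, which allows a choice that is closed under negation. -/
theorem trace_eq_sum_finrank_eigenspace (hA : A.IsSymmetric) (S : Finset ℂ)
    (hS : ∀ c, Module.End.eigenspace A c ≠ ⊥ → c ∈ S) :
    LinearMap.trace ℂ E A = ∑ c ∈ S, c * Module.finrank ℂ (Module.End.eigenspace A c) := by
  classical
  have hint : DirectSum.IsInternal fun c : ℂ => Module.End.eigenspace A c := by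
    rw [DirectSum.isInternal_submodule_iff_iSupIndep_and_iSup_eq_top]
    exact ⟨Module.End.eigenspaces_iSupIndep A, by
      rw [← Submodule.orthogonal_eq_bot_iff]; exact hA.orthogonalComplement_iSup_eigenspaces_eq_bot⟩
  have hmaps : ∀ c : ℂ, Set.MapsTo A (Module.End.eigenspace A c) (Module.End.eigenspace A c) := fun c =>
    Module.End.mapsTo_genEigenspace_of_comm (Commute.refl A) c 1
  rw [LinearMap.trace_eq_sum_trace_restrict' hint (finite_eigenspace_ne_bot A) hmaps]
  refine (Finset.sum_subset (fun c hc => hS c (by simpa using hc)) fun c _ hc => ?_).trans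
    (Finset.sum_congr rfl fun c _ => ?_)
  · have : Module.End.eigenspace A c = ⊥ := by simpa using hc
    have : Subsingleton (Module.End.eigenspace A c) := by rw [this]; infer_instance
    rw [Subsingleton.elim (A.restrict (hmaps c)) 0, map_zero]
  · have : A.restrict (hmaps c) = c • LinearMap.id := by
      ext x
      exact Module.End.mem_eigenspace_iff.1 x.2
    rw [this, map_smul, LinearMap.trace_id, smul_eq_mul]

/-- If a symmetric operator has trace zero and if its spectrum outside of `±1` is symmetric, then
its entire spectrum is symmetric. -/
theorem finrank_eigenspace_one_eq (hA : A.IsSymmetric) (htr : LinearMap.trace ℂ E A = 0)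
    (h : ∀ c : ℂ, c ^ 2 ≠ 1 →
      Module.finrank ℂ (Module.End.eigenspace A c) = Module.finrank ℂ (Module.End.eigenspace A (-c))) :
    Module.finrank ℂ (Module.End.eigenspace A 1) = Module.finrank ℂ (Module.End.eigenspace A (-1)) := by
  classical
  let m : ℂ → ℂ := fun c => Module.finrank ℂ (Module.End.eigenspace A c)
  let S₀ : Finset ℂ := (finite_eigenspace_ne_bot A).toFinset ∪ {1, -1}
  let S : Finset ℂ := S₀ ∪ S₀.image Neg.neg
  have hS : ∀ c, -c ∈ S ↔ c ∈ S := by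
    intro c
    simp only [S, Finset.mem_union, Finset.mem_image]
    constructor
    · rintro (h | ⟨a, ha, hac⟩)
      · exact Or.inr ⟨-c, h, neg_neg c⟩
      · exact Or.inl (neg_injective hac ▸ ha)
    · rintro (h | ⟨a, ha, rfl⟩)
      · exact Or.inr ⟨c, h, rfl⟩
      · exact Or.inl (by rwa [neg_neg])
  have h1 : ∑ c ∈ S, c * m c = 0 := by
    rw [← htr, trace_eq_sum_finrank_eigenspace hA S]
    intro c hc
    simp [S, S₀, hc]
  have h2 : ∑ c ∈ S, c * m (-c) = 0 := by
    rw [← neg_eq_zero, ← h1, ← Finset.sum_neg_distrib]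
    exact Finset.sum_nbij' Neg.neg Neg.neg (fun c hc => (hS c).2 hc) (fun c hc => (hS c).2 hc)
      (fun c _ => neg_neg c) (fun c _ => neg_neg c) (fun c _ => by ring)
  -- Only c = ±1 survive in the difference of the two sums, and both contribute m(1) - m(-1).
  have h3 : ∑ c ∈ ({1, -1} : Finset ℂ), c * (m c - m (-c)) = 0 := by
    rw [Finset.sum_subset (s₂ := S)]
    · rw [← sub_eq_zero.2 (h1.trans h2.symm), ← Finset.sum_sub_distrib]
      exact Finset.sum_congr rfl fun c _ => mul_sub _ _ _
    · intro c hc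
      simp only [S, S₀, Finset.mem_union]
      exact Or.inl (Or.inr hc)
    · intro c _ hc
      have : c ^ 2 ≠ 1 := by
        simpa using hc
      simp only [m, h c this, sub_self, mul_zero]
  rw [Finset.sum_pair (by norm_num), neg_neg] at h3
  have h4 : m 1 = m (-1) := by linear_combination h3 / 2
  exact Nat.cast_injective h4

end Trace

end

end Network

theorem EdgeParametrization.adj {V : Type*} {G : SimpleGraph V} (P : EdgeParametrization G)
    (e : G.edgeSet) : G.Adj (P.tail e) (P.head e) := by
  rw [← SimpleGraph.mem_edgeSet, P.ends_eq]
  exact e.2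

theorem EdgeParametrization.exists_edge {V : Type*} {G : SimpleGraph V} (P : EdgeParametrization G)
    {v w : V} (h : G.Adj v w) :
    ∃ e, (P.tail e = v ∧ P.head e = w) ∨ (P.tail e = w ∧ P.head e = v) :=
  ⟨⟨s(v, w), h⟩, Sym2.eq_iff.1 (P.ends_eq ⟨s(v, w), h⟩)⟩

theorem SimpleGraph.Reachable.of_adj_imp {V : Type*} {G : SimpleGraph V} {p : V → Prop}
    (hp : ∀ v w, G.Adj v w → p v → p w) {v w : V} (h : G.Reachable v w) (hv : p v) : p w := by
  rw [SimpleGraph.reachable_iff_reflTransGen] at h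
  induction h with
  | refl => exact hv
  | tail _ hadj ih => exact hp _ _ hadj ih

namespace Network

noncomputable section

/-! ### Constant and alternating functions on the components -/

section TwistedConstant

variable {V : Type*} (G : SimpleGraph V)

/-- The functions on the vertices that are multiplied by `c` along every edge. -/
def twistedConstant (c : ℂ) : Submodule ℂ (V → ℂ) where
  carrier := {φ | ∀ v w, G.Adj v w → φ w = c * φ v}
  zero_mem' := by simp
  add_mem' h h' v w hvw := by simp only [Pi.add_apply, h v w hvw, h' v w hvw, mul_add]
  smul_mem' a φ h v w hvw := by
    simp only [Pi.smul_apply, smul_eq_mul, h v w hvw]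
    ring

variable {G}

/-- The values of a function in the vertices that represent the connected components. -/
def componentValues (c : ℂ) : twistedConstant G c →ₗ[ℂ] (G.ConnectedComponent → ℂ) where
  toFun φ C := φ.1 C.out
  map_add' _ _ := rfl
  map_smul' _ _ := rfl

theorem reachable_out (v : V) : G.Reachable (G.connectedComponentMk v).out v :=
  SimpleGraph.ConnectedComponent.exact (Quot.out_eq (G.connectedComponentMk v))

theorem componentValues_injective (c : ℂ) :
    Function.Injective (componentValues (G := G) c) := by
  rw [injective_iff_map_eq_zero]
  intro φ h
  refine Subtype.ext (funext fun v => ?_)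
  exact (reachable_out v).of_adj_imp (p := fun v => φ.1 v = 0)
    (fun v w hvw hv => by rw [φ.2 v w hvw, hv, mul_zero]) (congrFun h _)

theorem card_connectedComponent_le_finrank [Finite V] [Fintype G.ConnectedComponent] :
    Fintype.card G.ConnectedComponent ≤ Module.finrank ℂ (twistedConstant G 1) := by
  let f : (G.ConnectedComponent → ℂ) →ₗ[ℂ] twistedConstant G 1 :=
    { toFun := fun g => ⟨fun v => g (G.connectedComponentMk v), fun v w hvw => by
        rw [one_mul]
        exact congrArg g (SimpleGraph.ConnectedComponent.sound hvw.reachable).symm⟩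
      map_add' := fun _ _ => rfl
      map_smul' := fun _ _ => rfl }
  rw [← Module.finrank_fintype_fun_eq_card (R := ℂ)]
  refine LinearMap.finrank_le_finrank_of_injective (f := f) ?_
  rw [injective_iff_map_eq_zero]
  intro g hg
  funext C
  induction C using SimpleGraph.ConnectedComponent.ind with
  | h v => exact congrFun (congrArg Subtype.val hg) v

/-- The dimension for 1 is at least the number of components, which bounds the dimension for -1.
Equality makes evaluation at the representatives surjective, so some alternating function is 1 at
all of them; its values are ±1 and it is a 2-colouring. -/
theorem isBipartite_of_finrank_le [Finite V]
    (h : Module.finrank ℂ (twistedConstant G 1) ≤ Module.finrank ℂ (twistedConstant G (-1))) :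
    G.IsBipartite := by
  classical
  have : Fintype G.ConnectedComponent := Fintype.ofFinite _
  have hle := LinearMap.finrank_le_finrank_of_injective (componentValues_injective (G := G) (-1))
  have heq : Module.finrank ℂ (twistedConstant G (-1)) =
      Module.finrank ℂ (G.ConnectedComponent → ℂ) := by
    refine le_antisymm hle ?_
    rw [Module.finrank_fintype_fun_eq_card]
    exact card_connectedComponent_le_finrank.trans h
  obtain ⟨φ, hφ⟩ := (LinearMap.injective_iff_surjective_of_finrank_eq_finrank heq).1
    (componentValues_injective (G := G) (-1)) 1
  have hsign : ∀ v, φ.1 v = 1 ∨ φ.1 v = -1 := fun v =>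
    (reachable_out v).of_adj_imp (p := fun v => φ.1 v = 1 ∨ φ.1 v = -1)
      (fun v w hvw hv => by
        rw [φ.2 v w hvw]
        rcases hv with hv | hv <;> rw [hv] <;> norm_num) (Or.inl (congrFun hφ _))
  refine ⟨SimpleGraph.Coloring.mk (fun v => if φ.1 v = 1 then 0 else 1) fun {v w} hvw => ?_⟩
  have := φ.2 v w hvw
  rcases hsign v with hv | hv <;> rw [hv] at this <;> norm_num at this <;>
    norm_num [hv, this]

end TwistedConstant

/-! ### The compression attached to the graph -/

section EndValues

variable {V : Type*} {G : SimpleGraph V} [Fintype G.edgeSet] (P : EdgeParametrization G)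

/-- As c = c⁻¹, the relation along an edge does not depend on its orientation. -/
theorem twistedConstant_eq_comap {c : ℂ} (hc : c ^ 2 = 1) :
    twistedConstant G c = (compressedEigenspace (swap (EuclideanSpace ℂ G.edgeSet))
      (LinearMap.range (endValues P)) c).comap (endValues P) := by
  ext φ
  rw [Submodule.mem_comap, mem_compressedEigenspace_of_sq_eq_one swap_swap swap_isSymmetric hc,
    and_iff_right ⟨φ, rfl⟩]
  constructor
  · intro h
    refine (WithLp.equiv 2 _).injective (Prod.ext ?_ ?_)
    · exact PiLp.ext fun e => h _ _ (P.adj e)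
    · exact PiLp.ext fun e => h _ _ (P.adj e).symm
  · intro h v w hvw
    have h1 : ∀ e, φ (P.head e) = c * φ (P.tail e) := fun e =>
      congrFun (congrArg (WithLp.ofLp ∘ WithLp.fst) h) e
    have h2 : ∀ e, φ (P.tail e) = c * φ (P.head e) := fun e =>
      congrFun (congrArg (WithLp.ofLp ∘ WithLp.snd) h) e
    obtain ⟨e, ⟨rfl, rfl⟩ | ⟨rfl, rfl⟩⟩ := P.exists_edge hvw
    · exact h1 e
    · exact h2 e

theorem finrank_comap_of_le_range {E F : Type*} [AddCommGroup E] [Module ℂ E] [AddCommGroup F]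
    [Module ℂ F] [FiniteDimensional ℂ E] (f : E →ₗ[ℂ] F) {p : Submodule ℂ F}
    (hp : p ≤ LinearMap.range f) :
    Module.finrank ℂ (p.comap f) = Module.finrank ℂ p + Module.finrank ℂ (LinearMap.ker f) := by
  rw [← LinearMap.finrank_range_add_finrank_ker (f.domRestrict (p.comap f)),
    LinearMap.range_domRestrict, Submodule.map_comap_eq, inf_eq_right.2 hp,
    ← Submodule.finrank_map_subtype_eq (p.comap f) (LinearMap.ker (f.domRestrict (p.comap f)))]
  have h : LinearMap.ker f ≤ p.comap f := fun x hx => by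
    rw [Submodule.mem_comap, LinearMap.mem_ker.1 hx]
    exact zero_mem _
  rw [LinearMap.ker_domRestrict, Submodule.map_comap_subtype,
    inf_eq_right.2 h]

/-- Functions supported on isolated vertices form the kernel of `endValues`; it adds the same
dimension for 1 and -1. -/
theorem isBipartite_of_finrank_compressedEigenspace_eq [Finite V]
    (h : Module.finrank ℂ (compressedEigenspace (swap (EuclideanSpace ℂ G.edgeSet))
        (LinearMap.range (endValues P)) 1) =
      Module.finrank ℂ (compressedEigenspace (swap (EuclideanSpace ℂ G.edgeSet))
        (LinearMap.range (endValues P)) (-1))) : G.IsBipartite := by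
  refine isBipartite_of_finrank_le ?_
  rw [twistedConstant_eq_comap P (one_pow 2), twistedConstant_eq_comap P (by norm_num),
    finrank_comap_of_le_range (endValues P) (p := compressedEigenspace _ _ _) inf_le_left, 
    finrank_comap_of_le_range (endValues P) (p := compressedEigenspace _ _ _) inf_le_left, h]

theorem inner_endValues (φ ψ : V → ℂ) : inner ℂ (endValues P φ) (endValues P ψ) =
    ∑ e, (ψ (P.tail e) * star (φ (P.tail e)) + ψ (P.head e) * star (φ (P.head e))) := by
  rw [WithLp.prod_inner_apply, PiLp.inner_apply, PiLp.inner_apply, ← Finset.sum_add_distrib]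
  rfl

theorem inner_endValues_swap (φ ψ : V → ℂ) : inner ℂ (endValues P φ) (swap _ (endValues P ψ)) =
    ∑ e, (ψ (P.head e) * star (φ (P.tail e)) + ψ (P.tail e) * star (φ (P.head e))) := by
  rw [WithLp.prod_inner_apply, PiLp.inner_apply, PiLp.inner_apply, ← Finset.sum_add_distrib]
  rfl

/-- If the images of the point masses under `T` are orthogonal to each other, and if each of them
is orthogonal to its image under `J`, then the compression of `J` to the range of `T` has
trace zero. -/
theorem trace_compression_range [Fintype V] [DecidableEq V] {K : Type*} [NormedAddCommGroup K]
    [InnerProductSpace ℂ K] (J : K →ₗ[ℂ] K) (T : (V → ℂ) →ₗ[ℂ] K)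
    (hT : ∀ v w, v ≠ w → inner ℂ (T (Pi.single v 1)) (T (Pi.single w 1)) = 0)
    (hJ : ∀ v, inner ℂ (T (Pi.single v 1)) (J (T (Pi.single v 1))) = 0) :
    LinearMap.trace ℂ _ (compression J (LinearMap.range T)) = 0 := by
  classical
  let t : V → LinearMap.range T := fun v => T.rangeRestrict (Pi.single v 1)
  -- Point masses with zero image (for `endValues`, those at isolated vertices) are discarded; the
  -- others are normalised to an orthonormal basis.
  let b : {v // t v ≠ 0} → LinearMap.range T := fun v => ((‖t v‖ : ℂ)⁻¹) • t v
  have hb : Orthonormal ℂ b := by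
    refine ⟨fun v => norm_smul_inv_norm v.2, fun v w hvw => ?_⟩
    have : inner ℂ (t v) (t w) = 0 := hT v w fun h => hvw (Subtype.ext h)
    change inner ℂ ((‖t v‖ : ℂ)⁻¹ • t v) ((‖t w‖ : ℂ)⁻¹ • t w) = 0
    rw [inner_smul_left, inner_smul_right, this, mul_zero, mul_zero]
  have hspan : ⊤ ≤ Submodule.span ℂ (Set.range b) := by
    rintro ⟨_, φ, rfl⟩ -
    have hφ : T.rangeRestrict φ = ∑ v, φ v • t v := by
      conv_lhs => rw [pi_eq_sum_univ' φ, map_sum]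
      exact Finset.sum_congr rfl fun v _ => map_smul _ _ _
    change T.rangeRestrict φ ∈ _
    rw [hφ]
    refine Submodule.sum_mem _ fun v _ => Submodule.smul_mem _ _ ?_
    by_cases hv : t v = 0
    · rw [hv]; exact zero_mem _
    · have : t v = (‖t v‖ : ℂ) • b ⟨v, hv⟩ := by
        rw [smul_smul, mul_inv_cancel₀ (by simpa using hv), one_smul]
      rw [this]
      exact Submodule.smul_mem _ _ (Submodule.subset_span ⟨_, rfl⟩)
  rw [LinearMap.trace_eq_sum_inner _ (OrthonormalBasis.mk hb hspan)]
  refine Finset.sum_eq_zero fun v _ => ?_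
  have : inner ℂ (t v) (compression J (LinearMap.range T) (t v)) = 0 := by
    rw [inner_compression]
    exact hJ v
  rw [OrthonormalBasis.coe_mk]
  change inner ℂ ((‖t v‖ : ℂ)⁻¹ • t v) (compression J _ ((‖t v‖ : ℂ)⁻¹ • t v)) = 0
  rw [map_smul, inner_smul_left, inner_smul_right, this, mul_zero, mul_zero]

/-- Distinct point masses have end values with disjoint supports. The swap pairs the two ends of an
edge, and these are distinct vertices. -/
theorem trace_compression_swap [Fintype V] :
    LinearMap.trace ℂ _ (compression (swap (EuclideanSpace ℂ G.edgeSet))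
      (LinearMap.range (endValues P))) = 0 := by
  classical
  refine trace_compression_range _ _ (fun v w h => ?_) fun v => ?_
  · rw [inner_endValues]
    refine Finset.sum_eq_zero fun e _ => ?_
    have h' : ∀ x, (Pi.single w 1 : V → ℂ) x * star ((Pi.single v 1 : V → ℂ) x) = 0 := by
      intro x
      by_cases hx : x = v
      · rw [hx, Pi.single_eq_of_ne h, zero_mul]
      · rw [Pi.single_eq_of_ne hx, star_zero, mul_zero]
    rw [h', h', add_zero]
  · rw [inner_endValues_swap]
    refine Finset.sum_eq_zero fun e _ => ?_
    have h' : ∀ x y, x ≠ y →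
        (Pi.single v 1 : V → ℂ) x * star ((Pi.single v 1 : V → ℂ) y) = 0 := by
      intro x y hxy
      by_cases hx : x = v
      · rw [Pi.single_eq_of_ne (i' := y) (hx ▸ hxy.symm), star_zero, mul_zero]
      · rw [Pi.single_eq_of_ne hx, zero_mul]
    rw [h' _ _ (P.adj e).ne, h' _ _ (P.adj e).ne.symm, add_zero]

/-- Multiplication of the boundary values by a function on the vertices. -/
def vertexMul (ε : V → ℂ) :
    WithLp 2 (EuclideanSpace ℂ G.edgeSet × EuclideanSpace ℂ G.edgeSet) →ₗ[ℂ]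
      WithLp 2 (EuclideanSpace ℂ G.edgeSet × EuclideanSpace ℂ G.edgeSet) where
  toFun y := WithLp.toLp 2 (WithLp.toLp 2 fun e => ε (P.tail e) * y.fst e,
    WithLp.toLp 2 fun e => ε (P.head e) * y.snd e)
  map_add' _ _ := (WithLp.equiv 2 _).injective (Prod.ext
    (PiLp.ext fun _ => mul_add _ _ _) (PiLp.ext fun _ => mul_add _ _ _))
  map_smul' _ _ := (WithLp.equiv 2 _).injective (Prod.ext
    (PiLp.ext fun _ => mul_left_comm _ _ _) (PiLp.ext fun _ => mul_left_comm _ _ _))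

theorem vertexMul_isSymmetric {ε : V → ℂ} (hε : ∀ v, star (ε v) = ε v) :
    (vertexMul P ε).IsSymmetric := by
  have hmul : ∀ v a b, b * star (ε v * a) = ε v * b * star a := by
    intro v a b
    rw [star_mul', hε]
    ring
  intro y z
  rw [WithLp.prod_inner_apply, WithLp.prod_inner_apply]
  congr 1
  · rw [PiLp.inner_apply, PiLp.inner_apply]
    refine Finset.sum_congr rfl fun e _ => ?_
    exact hmul _ _ _
  · rw [PiLp.inner_apply, PiLp.inner_apply]
    refine Finset.sum_congr rfl fun e _ => ?_
    exact hmul _ _ _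

/-- The sign `ε` of the colouring is opposite at the two ends of an edge, so multiplication by it
anticommutes with the swap. -/
theorem rank_compressedEigenspace_neg_of_isBipartite (hG : G.IsBipartite) (c : ℂ) :
    Module.rank ℂ (compressedEigenspace (swap (EuclideanSpace ℂ G.edgeSet))
        (LinearMap.range (endValues P)) c) =
      Module.rank ℂ (compressedEigenspace (swap (EuclideanSpace ℂ G.edgeSet))
        (LinearMap.range (endValues P)) (-c)) := by
  obtain ⟨C⟩ := hG
  let ε : V → ℂ := fun v => if C v = 0 then 1 else -1
  have hsq : ∀ v z, ε v * (ε v * z) = z := by intro v z; by_cases h : C v = 0 <;> simp [ε, h]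
  have hstar : ∀ v, star (ε v) = ε v := by intro v; by_cases h : C v = 0 <;> simp [ε, h]
  have hneg : ∀ v w, G.Adj v w → ε v = -ε w := by
    intro v w hvw
    have := C.valid hvw
    by_cases h : C v = 0 <;> by_cases h' : C w = 0 <;> simp only [ε, h, h'] <;> simp <;> omega
  refine rank_compressedEigenspace_neg (U := vertexMul P ε) ?_ (vertexMul_isSymmetric P hstar)
    ?_ ?_ c
  · intro y
    exact (WithLp.equiv 2 _).injective (Prod.ext (PiLp.ext fun e => hsq _ _)
      (PiLp.ext fun e => hsq _ _))
  · intro y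
    refine (WithLp.equiv 2 _).injective (Prod.ext (PiLp.ext fun e => ?_) (PiLp.ext fun e => ?_))
    · change ε (P.head e) * y.snd e = -(ε (P.tail e) * y.snd e)
      rw [hneg _ _ (P.adj e).symm, neg_mul]
    · change ε (P.tail e) * y.fst e = -(ε (P.head e) * y.fst e)
      rw [hneg _ _ (P.adj e), neg_mul]
  · rintro _ ⟨φ, rfl⟩
    exact ⟨fun v => ε v * φ v, rfl⟩

theorem isBipartite_iff_rank_compressedEigenspace [Fintype V] :
    G.IsBipartite ↔ ∀ c : ℂ, c ^ 2 ≠ 1 →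
      Module.rank ℂ (compressedEigenspace (swap (EuclideanSpace ℂ G.edgeSet))
          (LinearMap.range (endValues P)) c) =
        Module.rank ℂ (compressedEigenspace (swap (EuclideanSpace ℂ G.edgeSet))
          (LinearMap.range (endValues P)) (-c)) := by
  refine ⟨fun h c _ => rank_compressedEigenspace_neg_of_isBipartite P h c, fun h => ?_⟩
  refine isBipartite_of_finrank_compressedEigenspace_eq P ?_
  rw [← finrank_eigenspace_compression, ← finrank_eigenspace_compression]
  refine finrank_eigenspace_one_eq (compression_isSymmetric _ swap_isSymmetric)
    (trace_compression_swap P) fun c hc => ?_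
  rw [finrank_eigenspace_compression, finrank_eigenspace_compression]
  exact congrArg Cardinal.toNat (h c hc)

end EndValues

/-! ### From immanent eigenvalues to cosines -/

section Immanent

variable {X : Type*} [AddCommGroup X] [Module ℂ X]

theorem mem_immanentEigenvalues_iff {T : X →ₗ.[ℂ] X} {μ : ℂ} :
    μ ∈ immanentEigenvalues T ↔ multiplicity T μ ≠ 0 ∧ Complex.sin (Complex.sqrt μ) ≠ 0 := by
  rw [multiplicity, Ne, Submodule.rank_eq_zero]
  rfl

/-- Where the sine is nonzero, not being an eigenvalue means multiplicity 0, so equality of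
multiplicities includes equality of the sets. -/
theorem same_immanentEigenvalues_iff {S T : X →ₗ.[ℂ] X} :
    (immanentEigenvalues S = immanentEigenvalues T ∧
      ∀ μ ∈ immanentEigenvalues S, multiplicity S μ = multiplicity T μ) ↔
    ∀ μ, Complex.sin (Complex.sqrt μ) ≠ 0 → multiplicity S μ = multiplicity T μ := by
  constructor
  · rintro ⟨h, h'⟩ μ hμ
    by_cases hS : μ ∈ immanentEigenvalues S
    · exact h' μ hS
    · have hT := h ▸ hS
      rw [mem_immanentEigenvalues_iff] at hS hT
      rw [not_not.1 fun h0 => hS ⟨h0, hμ⟩, not_not.1 fun h0 => hT ⟨h0, hμ⟩]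
  · intro h
    refine ⟨Set.ext fun μ => ?_, fun μ hμ => h μ hμ.2⟩
    rw [mem_immanentEigenvalues_iff, mem_immanentEigenvalues_iff]
    exact and_congr_left fun hμ => by rw [h μ hμ]

/-- The root of s² is ±s, and cosine is even. -/
theorem exists_cos_sqrt_eq (c : ℂ) : ∃ μ, Complex.cos (Complex.sqrt μ) = c := by
  obtain ⟨s, rfl⟩ := Complex.cos_surjective c
  refine ⟨s ^ 2, ?_⟩
  rcases sq_eq_sq_iff_eq_or_eq_neg.1 (sqrt_sq (s ^ 2)) with h | h
  · rw [h]
  · rw [h, Complex.cos_neg]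

theorem sin_ne_zero_iff_cos_sq_ne_one (z : ℂ) : Complex.sin z ≠ 0 ↔ Complex.cos z ^ 2 ≠ 1 := by
  rw [Complex.cos_sq', Ne, Ne, sub_eq_self, sq_eq_zero_iff]

end Immanent

end

end Network

theorem corollary4p5 {V : Type*} [Fintype V] (G : SimpleGraph V) [Fintype G.edgeSet]
    (P : EdgeParametrization G) :
    G.IsBipartite ↔
      Network.immanentEigenvalues (-Network.laplacianCK P) =
          Network.immanentEigenvalues (-Network.laplacianKC P) ∧
        ∀ μ ∈ Network.immanentEigenvalues (-Network.laplacianCK P),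
          Network.multiplicity (-Network.laplacianCK P) μ =
            Network.multiplicity (-Network.laplacianKC P) μ := by
  rw [Network.same_immanentEigenvalues_iff, Network.isBipartite_iff_rank_compressedEigenspace P]
  have key : ∀ μ, Complex.sin (Complex.sqrt μ) ≠ 0 →
      (Network.multiplicity (-Network.laplacianCK P) μ =
        Network.multiplicity (-Network.laplacianKC P) μ ↔ _) := fun μ hμ => by
    rw [Network.laplacianCK, Network.laplacianKC, Network.multiplicity_neg_laplacian _ hμ,
      Network.multiplicity_neg_laplacian _ hμ,
      Network.rank_compressedEigenspace_orthogonal Network.swap_swap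
        (Submodule.orthogonal_orthogonal _) ((Network.sin_ne_zero_iff_cos_sq_ne_one _).1 hμ)]
  constructor
  · intro h μ hμ
    exact (key μ hμ).2 (h _ ((Network.sin_ne_zero_iff_cos_sq_ne_one _).1 hμ))
  · intro h c hc
    obtain ⟨μ, rfl⟩ := Network.exists_cos_sqrt_eq c
    have hμ := (Network.sin_ne_zero_iff_cos_sq_ne_one _).2 hc
    exact (key μ hμ).1 (h μ hμ)
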